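/- Let $\mathbb U=\{z\in\mathbb C:|z|<1\}$ and $0\le\beta<1$. Let $\mathcal H^{\beta}_{\sigma}$ be the class of functions $f(z)=z+\sum_{n\ge 2}a_nz^n$, analytic and univalent in $\mathbb U$, such that the inverse $f^{-1}$ (defined near $0$) extends to a univalent analytic function $g$ on $\mathbb U$, and $$f'(z)\prec\frac{1+(1-2\beta)z}{1-z}\quad\text{and}\quad g'(w)\prec\frac{1+(1-2\beta)w}{1-w}\qquad(z,w\in\mathbb U).$$ Here $F\prec\varphi$ (subordination) means that $F(z)=\varphi(\omega(z))$ for all $z\in\mathbb U$, for some analytic $\omega$ on $\mathbb U$ with $\omega(0)=0$ and $|\omega(z)|<1$. (This is the case $\lambda=0$ of the class $\mathcal G^{\lambda}_{\sigma}(\varphi)$ with $\varphi(z)=\frac{1+(1-2\beta)z}{1-z}$, in which $f'$ and $g'$ are replaced by $(1-\lambda)f'(z)+\lambda\left(1+\frac{zf''(z)}{f'(z)}\right)$ and the same expression in $g$.) If $f\in\mathcal H^{\beta}_{\sigma}$, then $$|a_2a_4-a_3^2|\le\begin{cases}\dfrac{(1-\beta)^2\left[1+2(1-\beta)^2\right]}{2},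 & \beta\in\left[0,\frac{11-\sqrt{37}}{12}\right],\\[3mm] \dfrac{(1-\beta)^2\left(60\beta^2-84\beta-25\right)}{16\left(9\beta^2-15\beta+1\right)}, & \beta\in\left(\frac{11-\sqrt{37}}{12},1\right).\end{cases}$$ -/

import Mathlib

open scoped Topology

namespace BiUnivalent

/-- The open unit disc `𝕌`. -/
def unitDisc : Set ℂ := Metric.ball (0 : ℂ) 1

/-- The class `𝒜`: functions analytic in the unit disc with `f(z) = z + ∑_{n ≥ 2} aₙ zⁿ`,
that is, `f(0) = 0` and `f'(0) = 1`. -/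
def ClassA (f : ℂ → ℂ) : Prop :=
  DifferentiableOn ℂ f unitDisc ∧ f 0 = 0 ∧ deriv f 0 = 1

/-- The class `𝒮` of functions in `𝒜` that are univalent in the unit disc. -/
def ClassS (f : ℂ → ℂ) : Prop :=
  ClassA f ∧ Set.InjOn f unitDisc

/-- The coefficient `aₙ` of `zⁿ` in the Taylor series of `f` at `0`. -/
noncomputable def coeff (f : ℂ → ℂ) (n : ℕ) : ℂ :=
  iteratedDeriv n f 0 / (n.factorial : ℂ)

/-- Subordination `F ≺ φ` in the unit disc: `F = φ ∘ w` for a Schwarz function `w`. -/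
def Subordinate (F φ : ℂ → ℂ) : Prop :=
  ∃ w : ℂ → ℂ, DifferentiableOn ℂ w unitDisc ∧ w 0 = 0 ∧ (∀ z ∈ unitDisc, ‖w z‖ < 1) ∧
    ∀ z ∈ unitDisc, F z = φ (w z)

/-- `g` is the univalent analytic continuation to the unit disc of the inverse `f⁻¹`, which is
a priori defined only near `0 = f(0)`. On the disc, `g` is unique by the identity theorem. -/
def IsUnivalentInverse (f g : ℂ → ℂ) : Prop :=
  DifferentiableOn ℂ g unitDisc ∧ Set.InjOn g unitDisc ∧ ∀ᶠ z in 𝓝 (0 : ℂ), g (f z) = z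

/-- The class `σ` of bi-univalent functions in the unit disc. -/
def ClassSigma (f : ℂ → ℂ) : Prop :=
  ClassS f ∧ ∃ g : ℂ → ℂ, IsUnivalentInverse f g

/-- The expression `(1 - λ) f'(z) + λ (1 + z f''(z) / f'(z))`. -/
noncomputable def gExpr (lam : ℝ) (f : ℂ → ℂ) (z : ℂ) : ℂ :=
  (1 - (lam : ℂ)) * deriv f z + (lam : ℂ) * (1 + z * deriv (deriv f) z / deriv f z)

/-- The class `𝒢^λ_σ(φ)`: bi-univalent `f` such that the expression above is subordinate to `φ`
both for `f` and for `g = f⁻¹`. -/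
def ClassG (lam : ℝ) (φ : ℂ → ℂ) (f : ℂ → ℂ) : Prop :=
  ClassSigma f ∧ Subordinate (gExpr lam f) φ ∧
    ∃ g : ℂ → ℂ, IsUnivalentInverse f g ∧ Subordinate (gExpr lam g) φ

/-- The function `z ↦ (1 + (1 - 2β) z) / (1 - z)`. -/
noncomputable def phi (β : ℝ) (z : ℂ) : ℂ :=
  (1 + (1 - 2 * (β : ℂ)) * z) / (1 - z)

/-- The class `ℋ^β_σ = 𝒢^0_σ((1 + (1 - 2β) z) / (1 - z))`. -/
def ClassH (β : ℝ) (f : ℂ → ℂ) : Prop :=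
  ClassG 0 (phi β) f

end BiUnivalent

/-! Put t = 1 - β and write f' = φ(z h(z)), where |h| ≤ 1 has coefficients a, b, c; let a', b', c'
belong to g. Inverting the series forces a' = -a, and eliminating between f and g expresses (a₂a₄ -
a₃²)/t² through a, b, b', c, c'. Two Schur steps bound b and c in terms of r = |a| and a parameter l
∈ [0, 1] (`norm_coeff_le_of_norm_le_one`). The triangle inequality bound is largest when both
parameters equal 1 (`triangle_bound_le`), leaving a quadratic in x = r² on [0, 1]. The two cases are
its maximum at x = 1 and at an interior vertex. -/

namespace BiUnivalent

open Filter Metric Set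

/-! ### Third-order Taylor expansions. -/

/-- `f` has third-order Taylor polynomial `a₀ + a₁ z + a₂ z² + a₃ z³` at `0`. -/
def Jet (f : ℂ → ℂ) (a₀ a₁ a₂ a₃ : ℂ) : Prop :=
  ∃ r : ℂ → ℂ, ContinuousAt r 0 ∧
    ∀ᶠ z in 𝓝 (0 : ℂ), f z = a₀ + a₁ * z + a₂ * z ^ 2 + a₃ * z ^ 3 + z ^ 4 * r z

namespace Jet

variable {f g : ℂ → ℂ} {a₀ a₁ a₂ a₃ b₀ b₁ b₂ b₃ : ℂ}

theorem const (c : ℂ) : Jet (fun _ ↦ c) c 0 0 0 :=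
  ⟨fun _ ↦ 0, by fun_prop, by simp⟩

theorem id : Jet (fun z ↦ z) 0 1 0 0 :=
  ⟨fun _ ↦ 0, by fun_prop, by simp⟩

theorem congr (hf : Jet f a₀ a₁ a₂ a₃) (h : ∀ᶠ z in 𝓝 (0 : ℂ), g z = f z) :
    Jet g a₀ a₁ a₂ a₃ := by
  obtain ⟨r, hr, hf⟩ := hf
  exact ⟨r, hr, by filter_upwards [hf, h] with z h₁ h₂; rw [h₂, h₁]⟩

theorem add (hf : Jet f a₀ a₁ a₂ a₃) (hg : Jet g b₀ b₁ b₂ b₃) :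
    Jet (fun z ↦ f z + g z) (a₀ + b₀) (a₁ + b₁) (a₂ + b₂) (a₃ + b₃) := by
  obtain ⟨r, hr, hf⟩ := hf
  obtain ⟨s, hs, hg⟩ := hg
  refine ⟨fun z ↦ r z + s z, by fun_prop, ?_⟩
  filter_upwards [hf, hg] with z h₁ h₂
  rw [h₁, h₂]; ring

theorem mul (hf : Jet f a₀ a₁ a₂ a₃) (hg : Jet g b₀ b₁ b₂ b₃) :
    Jet (fun z ↦ f z * g z) (a₀ * b₀) (a₀ * b₁ + a₁ * b₀) (a₀ * b₂ + a₁ * b₁ + a₂ * b₀)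
      (a₀ * b₃ + a₁ * b₂ + a₂ * b₁ + a₃ * b₀) := by
  obtain ⟨r, hr, hf⟩ := hf
  obtain ⟨s, hs, hg⟩ := hg
  refine ⟨fun z ↦ (a₁ * b₃ + a₂ * b₂ + a₃ * b₁) + (a₂ * b₃ + a₃ * b₂) * z + a₃ * b₃ * z ^ 2 +
    (a₀ + a₁ * z + a₂ * z ^ 2 + a₃ * z ^ 3) * s z +
    (b₀ + b₁ * z + b₂ * z ^ 2 + b₃ * z ^ 3) * r z + z ^ 4 * r z * s z, by fun_prop, ?_⟩
  filter_upwards [hf, hg] with z h₁ h₂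
  rw [h₁, h₂]; ring

theorem sub (hf : Jet f a₀ a₁ a₂ a₃) (hg : Jet g b₀ b₁ b₂ b₃) :
    Jet (fun z ↦ f z - g z) (a₀ - b₀) (a₁ - b₁) (a₂ - b₂) (a₃ - b₃) := by
  obtain ⟨r, hr, hf⟩ := hf
  obtain ⟨s, hs, hg⟩ := hg
  refine ⟨fun z ↦ r z - s z, by fun_prop, ?_⟩
  filter_upwards [hf, hg] with z h₁ h₂
  rw [h₁, h₂]; ring

/-- Substitution of a function vanishing at `0`. -/
theorem comp (hf : Jet f a₀ a₁ a₂ a₃) (hg : Jet g 0 b₁ b₂ b₃) (hg₀ : g 0 = 0)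
    (hgc : ContinuousAt g 0) :
    Jet (fun z ↦ f (g z)) a₀ (a₁ * b₁) (a₁ * b₂ + a₂ * b₁ ^ 2)
      (a₁ * b₃ + 2 * a₂ * b₁ * b₂ + a₃ * b₁ ^ 3) := by
  obtain ⟨r, hr, hf⟩ := hf
  obtain ⟨s, hs, hg⟩ := hg
  have hrg : ContinuousAt (fun z ↦ r (g z)) 0 :=
    ContinuousAt.comp (g := r) (by rwa [hg₀]) hgc
  have ht : Tendsto g (𝓝 0) (𝓝 0) := by simpa [ContinuousAt, hg₀] using hgc
  have hq : Jet (fun z ↦ b₁ * z + b₂ * z ^ 2 + b₃ * z ^ 3 + z ^ 4 * s z) 0 b₁ b₂ b₃ :=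
    ⟨s, hs, by simp⟩
  have hp := ((((const a₀).add ((const a₁).mul hq)).add ((const a₂).mul (hq.mul hq))).add
    ((const a₃).mul (hq.mul (hq.mul hq))))
  -- Since `g` vanishes at 0, z⁴ factors out of `g z ^ 4`.
  have hrem : Jet (fun z ↦ z ^ 4 * ((b₁ + b₂ * z + b₃ * z ^ 2 + z ^ 3 * s z) ^ 4 * r (g z)))
      0 0 0 0 :=
    ⟨fun z ↦ (b₁ + b₂ * z + b₃ * z ^ 2 + z ^ 3 * s z) ^ 4 * r (g z),
      ContinuousAt.mul (by fun_prop) hrg, by simp⟩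
  have := (hp.add hrem).congr (g := fun z ↦ f (g z)) (by
    filter_upwards [ht.eventually hf, hg] with z h₁ h₂
    rw [h₁, h₂]; ring)
  convert this using 1 <;> ring

/-- Letting z → 0 gives c = 0; the neighbourhood is punctured so that z can then be cancelled and
the argument iterated. -/
theorem eq_zero_of_eventually {c : ℂ} {r : ℂ → ℂ} (hr : ContinuousAt r 0)
    (h : ∀ᶠ z in 𝓝[≠] (0 : ℂ), c + z * r z = 0) : c = 0 ∧ ∀ᶠ z in 𝓝[≠] (0 : ℂ), r z = 0 := by
  have hc : c = 0 := by
    have h₁ : Tendsto (fun z ↦ c + z * r z) (𝓝[≠] 0) (𝓝 (c + 0 * r 0)) :=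
      (ContinuousAt.tendsto (f := fun z ↦ c + z * r z) (by fun_prop)).mono_left
        nhdsWithin_le_nhds
    have h₂ : Tendsto (fun z ↦ c + z * r z) (𝓝[≠] (0 : ℂ)) (𝓝 0) :=
      tendsto_const_nhds.congr' (h.mono fun z hz ↦ hz.symm)
    simpa using tendsto_nhds_unique h₁ h₂
  refine ⟨hc, ?_⟩
  filter_upwards [h, self_mem_nhdsWithin] with z hz hz₀
  simpa [hc, show z ≠ 0 from hz₀] using hz

theorem unique (hf : Jet f a₀ a₁ a₂ a₃) (hg : Jet f b₀ b₁ b₂ b₃) :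
    a₀ = b₀ ∧ a₁ = b₁ ∧ a₂ = b₂ ∧ a₃ = b₃ := by
  obtain ⟨r, hr, h⟩ := hf.sub hg
  have h₀ : ∀ᶠ z in 𝓝[≠] (0 : ℂ), (a₀ - b₀) + z * ((a₁ - b₁) + z * ((a₂ - b₂) +
      z * ((a₃ - b₃) + z * r z))) = 0 := by
    filter_upwards [h.filter_mono nhdsWithin_le_nhds] with z hz
    linear_combination -hz
  obtain ⟨e₀, h₁⟩ := eq_zero_of_eventually (by fun_prop) h₀
  obtain ⟨e₁, h₂⟩ := eq_zero_of_eventually (by fun_prop) h₁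
  obtain ⟨e₂, h₃⟩ := eq_zero_of_eventually (by fun_prop) h₂
  obtain ⟨e₃, -⟩ := eq_zero_of_eventually hr h₃
  exact ⟨sub_eq_zero.1 e₀, sub_eq_zero.1 e₁, sub_eq_zero.1 e₂, sub_eq_zero.1 e₃⟩

/-- The Taylor polynomial of an analytic function. -/
theorem of_analyticAt (hf : AnalyticAt ℂ f 0) :
    Jet f (coeff f 0) (coeff f 1) (coeff f 2) (coeff f 3) := by
  set p := FormalMultilinearSeries.ofScalars ℂ (fun n ↦ coeff f n)
  have hp : ∀ n, p.coeff n = coeff f n := fun n ↦ by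
    simp [p, FormalMultilinearSeries.coeff_ofScalars]
  have h₀ : HasFPowerSeriesAt f p 0 := hf.hasFPowerSeriesAt
  -- Each `dslope` peels off one coefficient; the fourth is the remainder.
  have key : ∀ {F : ℂ → ℂ} {q : FormalMultilinearSeries ℂ ℂ ℂ}, HasFPowerSeriesAt F q 0 →
      ∀ z, F z = q.coeff 0 + z * dslope F 0 z := fun {F q} h z ↦ by
    have h' := sub_smul_dslope F 0 z
    rw [smul_eq_mul, sub_zero] at h'
    have h₂ : q.coeff 0 = F 0 := h.coeff_zero _
    rw [h', h₂]; ring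
  have h₁ := h₀.has_fpower_series_dslope_fslope
  have h₂ := h₁.has_fpower_series_dslope_fslope
  have h₃ := h₂.has_fpower_series_dslope_fslope
  have h₄ := h₃.has_fpower_series_dslope_fslope
  refine ⟨_, h₄.continuousAt, Eventually.of_forall fun z ↦ ?_⟩
  rw [key h₀ z, key h₁ z, key h₂ z, key h₃ z]
  simp only [FormalMultilinearSeries.coeff_fslope, hp, zero_add]
  ring

end Jet

/-! ### Schur parameters of bounded functions. -/

theorem isOpen_unitDisc : IsOpen unitDisc := isOpen_ball

theorem unitDisc_mem_nhds : unitDisc ∈ 𝓝 (0 : ℂ) := ball_mem_nhds 0 one_pos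

theorem analyticAt_zero {f : ℂ → ℂ} (hf : DifferentiableOn ℂ f unitDisc) : AnalyticAt ℂ f 0 :=
  hf.analyticAt unitDisc_mem_nhds

/-- Order three suffices throughout because a₄ is read off from f'. -/
theorem jet_deriv {f : ℂ → ℂ} (hf : AnalyticAt ℂ f 0) :
    Jet (deriv f) (deriv f 0) (2 * coeff f 2) (3 * coeff f 3) (4 * coeff f 4) := by
  have := Jet.of_analyticAt hf.deriv
  simp only [coeff, ← iteratedDeriv_succ'] at this ⊢
  norm_num [Nat.factorial] at this ⊢
  convert this using 1 <;> ring

/-- Shows that the disc automorphism moving a to 0 is bounded by 1. -/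
theorem norm_normSq_identity (a b : ℂ) :
    ‖1 - (starRingEnd ℂ) a * b‖ ^ 2 - ‖b - a‖ ^ 2 = (1 - ‖a‖ ^ 2) * (1 - ‖b‖ ^ 2) := by
  simp only [Complex.sq_norm, Complex.normSq_apply, Complex.sub_re, Complex.sub_im,
    Complex.mul_re, Complex.mul_im, Complex.conj_re, Complex.conj_im, Complex.one_re,
    Complex.one_im]
  ring

/-- One step of the Schur algorithm. -/
theorem exists_schur_step {h : ℂ → ℂ} (hd : DifferentiableOn ℂ h unitDisc)
    (hb : ∀ z ∈ unitDisc, ‖h z‖ ≤ 1) :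
    ∃ k : ℂ → ℂ, DifferentiableOn ℂ k unitDisc ∧ (∀ z ∈ unitDisc, ‖k z‖ ≤ 1) ∧
      ∀ z ∈ unitDisc, h z = h 0 + z * (k z * (1 - (starRingEnd ℂ) (h 0) * h z)) := by
  have h0 : (0 : ℂ) ∈ unitDisc := mem_ball_self one_pos
  have hpre : IsPreconnected unitDisc := (convex_ball (0 : ℂ) 1).isPreconnected
  -- If |h| attains 1, then h is constant and k = 0 fits the division-free relation.
  by_cases hmax : ∃ c ∈ unitDisc, ‖h c‖ = 1
  · obtain ⟨c, hc, hc₁⟩ := hmax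
    have hm : IsMaxOn (norm ∘ h) unitDisc c := fun z hz ↦ by
      simpa [hc₁] using hb z hz
    have heq := Complex.eqOn_of_isPreconnected_of_isMaxOn_norm hpre isOpen_unitDisc hd hc hm
    refine ⟨fun _ ↦ 0, by fun_prop, by simp, fun z hz ↦ ?_⟩
    rw [heq hz, heq h0]; simp
  · push Not at hmax
    have hlt : ∀ z ∈ unitDisc, ‖h z‖ < 1 := fun z hz ↦ lt_of_le_of_ne (hb z hz) (hmax z hz)
    set a := h 0 with ha
    have hden : ∀ z ∈ unitDisc, 1 - (starRingEnd ℂ) a * h z ≠ 0 := fun z hz he ↦ by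
      have h₁ := congrArg norm (sub_eq_zero.1 he)
      rw [norm_one, norm_mul, RCLike.norm_conj] at h₁
      nlinarith [hlt z hz, hlt 0 h0, norm_nonneg a, norm_nonneg (h z)]
    set m : ℂ → ℂ := fun z ↦ (h z - a) / (1 - (starRingEnd ℂ) a * h z) with hm
    have hmd : DifferentiableOn ℂ m unitDisc :=
      (hd.sub_const a).div ((hd.const_mul _).const_sub 1) hden
    have hm0 : m 0 = 0 := by simp [hm, ha]
    have hmaps : MapsTo m (ball 0 1) (closedBall (m 0) 1) := fun z hz ↦ by
      rw [hm0, mem_closedBall_zero_iff, hm, norm_div,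
        div_le_one (norm_pos_iff.2 (hden z hz))]
      refine le_of_sq_le_sq ?_ (norm_nonneg _)
      have h₁ := norm_normSq_identity a (h z)
      have h₂ : 0 ≤ (1 - ‖a‖ ^ 2) * (1 - ‖h z‖ ^ 2) := by
        refine mul_nonneg ?_ ?_
        · nlinarith [hlt 0 h0, norm_nonneg a]
        · nlinarith [hlt z hz, norm_nonneg (h z)]
      linarith
    -- Schwarz's lemma: m(0) = 0, so m(z)/z is bounded by 1.
    refine ⟨dslope m 0, (Complex.differentiableOn_dslope unitDisc_mem_nhds).2 hmd,
      fun z hz ↦ ?_, fun z hz ↦ ?_⟩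
    · simpa using Complex.norm_dslope_le_div_of_mapsTo_ball hmd hmaps hz
    · have h₁ := sub_smul_dslope m 0 z
      rw [hm0, smul_eq_mul, sub_zero, sub_zero] at h₁
      rw [← mul_assoc, h₁, hm]
      simp only
      rw [div_mul_cancel₀ _ (hden z hz)]
      ring

/-- Coefficient bounds for a function bounded by one on the disc. -/
theorem norm_coeff_le_of_norm_le_one {h : ℂ → ℂ} (hd : DifferentiableOn ℂ h unitDisc)
    (hb : ∀ z ∈ unitDisc, ‖h z‖ ≤ 1) :
    ‖coeff h 0‖ ≤ 1 ∧ ∃ l : ℝ, 0 ≤ l ∧ l ≤ 1 ∧ ‖coeff h 1‖ = (1 - ‖coeff h 0‖ ^ 2) * l ∧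
      ‖coeff h 2‖ ≤ (1 - ‖coeff h 0‖ ^ 2) * ((1 - l ^ 2) + ‖coeff h 0‖ * l ^ 2) := by
  have h0 : (0 : ℂ) ∈ unitDisc := mem_ball_self one_pos
  have c0 : ∀ F : ℂ → ℂ, coeff F 0 = F 0 := fun F ↦ by simp [coeff]
  have step : ∀ {F k : ℂ → ℂ}, DifferentiableOn ℂ F unitDisc → DifferentiableOn ℂ k unitDisc →
      (∀ z ∈ unitDisc, F z = F 0 + z * (k z * (1 - (starRingEnd ℂ) (F 0) * F z))) →
      coeff F 1 = (1 - ((‖coeff F 0‖ ^ 2 : ℝ) : ℂ)) * coeff k 0 ∧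
      coeff F 2 = (1 - ((‖coeff F 0‖ ^ 2 : ℝ) : ℂ)) * coeff k 1 -
        (starRingEnd ℂ) (coeff F 0) * coeff k 0 * coeff F 1 := by
    intro F k hF hk hrel
    have jF := Jet.of_analyticAt (analyticAt_zero hF)
    have jk := Jet.of_analyticAt (analyticAt_zero hk)
    have j := ((Jet.const (F 0)).add (Jet.id.mul (jk.mul ((Jet.const 1).sub
      ((Jet.const ((starRingEnd ℂ) (F 0))).mul jF))))).congr
      (Filter.eventually_of_mem unitDisc_mem_nhds hrel)
    obtain ⟨-, e₁, e₂, -⟩ := jF.unique j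
    have hn : ((‖coeff F 0‖ ^ 2 : ℝ) : ℂ) = (starRingEnd ℂ) (coeff F 0) * coeff F 0 := by
      rw [mul_comm, Complex.mul_conj, Complex.normSq_eq_norm_sq]
    rw [hn]
    simp only [c0] at e₁ e₂ ⊢
    exact ⟨by linear_combination e₁, by linear_combination e₂⟩
  obtain ⟨k, hkd, hkb, hk⟩ := exists_schur_step hd hb
  obtain ⟨m, hmd, hmb, hm⟩ := exists_schur_step hkd hkb
  obtain ⟨e₁, e₂⟩ := step hd hkd hk
  obtain ⟨e₃, -⟩ := step hkd hmd hm
  have b₀ : ‖coeff h 0‖ ≤ 1 := by rw [c0]; exact hb 0 h0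
  have b₁ : ‖coeff k 0‖ ≤ 1 := by rw [c0]; exact hkb 0 h0
  have b₂ : ‖coeff m 0‖ ≤ 1 := by rw [c0]; exact hmb 0 h0
  have nrm : ∀ x : ℂ, ‖x‖ ≤ 1 → 0 ≤ 1 - ‖x‖ ^ 2 ∧
      ‖(1 - ((‖x‖ ^ 2 : ℝ) : ℂ))‖ = 1 - ‖x‖ ^ 2 := fun x hx ↦ by
    have : 0 ≤ 1 - ‖x‖ ^ 2 := by nlinarith [norm_nonneg x]
    refine ⟨this, ?_⟩
    rw [← Complex.ofReal_one, ← Complex.ofReal_sub, Complex.norm_real, Real.norm_of_nonneg this]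
  obtain ⟨p₀, n₀⟩ := nrm _ b₀
  obtain ⟨p₁, n₁⟩ := nrm _ b₁
  have k₁ : ‖coeff h 1‖ = (1 - ‖coeff h 0‖ ^ 2) * ‖coeff k 0‖ := by rw [e₁, norm_mul, n₀]
  have k₂ : ‖coeff k 1‖ ≤ 1 - ‖coeff k 0‖ ^ 2 := by
    rw [e₃, norm_mul, n₁]; exact mul_le_of_le_one_right p₁ b₂
  refine ⟨b₀, ‖coeff k 0‖, norm_nonneg _, b₁, k₁, ?_⟩
  calc ‖coeff h 2‖ ≤ (1 - ‖coeff h 0‖ ^ 2) * ‖coeff k 1‖ +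
        ‖coeff h 0‖ * ‖coeff k 0‖ * ‖coeff h 1‖ := by
        rw [e₂]
        refine (norm_sub_le _ _).trans_eq ?_
        rw [norm_mul, norm_mul, norm_mul, n₀, RCLike.norm_conj]
    _ ≤ (1 - ‖coeff h 0‖ ^ 2) * (1 - ‖coeff k 0‖ ^ 2) +
        ‖coeff h 0‖ * ‖coeff k 0‖ * ((1 - ‖coeff h 0‖ ^ 2) * ‖coeff k 0‖) := by
        rw [k₁]; gcongr
    _ = _ := by ring

/-! ### Coefficients of f and of its inverse. -/

/-- If `f' ≺ (1 + (1 - 2β)z)/(1 - z)`, the coefficients of `f` are polynomials in those of a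
function bounded by one. -/
theorem coeff_of_deriv_subordinate {β : ℝ} {f : ℂ → ℂ} (hf : AnalyticAt ℂ f 0)
    (hs : Subordinate (gExpr 0 f) (phi β)) :
    ∃ a b c : ℂ, coeff f 2 = (1 - β) * a ∧ 3 * coeff f 3 = 2 * (1 - β) * (b + a ^ 2) ∧
      2 * coeff f 4 = (1 - β) * (c + 2 * a * b + a ^ 3) ∧
      ‖a‖ ≤ 1 ∧ ∃ l : ℝ, 0 ≤ l ∧ l ≤ 1 ∧ ‖b‖ = (1 - ‖a‖ ^ 2) * l ∧
        ‖c‖ ≤ (1 - ‖a‖ ^ 2) * ((1 - l ^ 2) + ‖a‖ * l ^ 2) := by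
  obtain ⟨w, hwd, hw0, hwb, hw⟩ := hs
  have hmaps : MapsTo w (ball 0 1) (closedBall (w 0) 1) := fun z hz ↦ by
    rw [hw0, mem_closedBall_zero_iff]; exact (hwb z hz).le
  have hhd := (Complex.differentiableOn_dslope unitDisc_mem_nhds).2 hwd
  have hhb : ∀ z ∈ unitDisc, ‖dslope w 0 z‖ ≤ 1 := fun z hz ↦ by
    simpa using Complex.norm_dslope_le_div_of_mapsTo_ball hwd hmaps hz
  refine ⟨coeff (dslope w 0) 0, coeff (dslope w 0) 1, coeff (dslope w 0) 2, ?_⟩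
  have hww : ∀ z, w z = z * dslope w 0 z := fun z ↦ by
    have := sub_smul_dslope w 0 z
    rw [hw0, smul_eq_mul, sub_zero, sub_zero] at this
    exact this.symm
  have jw := (Jet.id.mul (Jet.of_analyticAt (analyticAt_zero hhd))).congr
    (Filter.Eventually.of_forall hww)
  have jf := jet_deriv hf
  have jl := jf.mul ((Jet.const 1).sub jw)
  -- Clearing the denominator 1 - w leaves only sums and products to expand.
  have jr := ((Jet.const 1).add ((Jet.const (1 - 2 * (β : ℂ))).mul jw)).congr
    (g := fun z ↦ deriv f z * (1 - w z)) (by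
      filter_upwards [unitDisc_mem_nhds] with z hz
      have h₁ := hw z hz
      have h₂ : 1 - w z ≠ 0 := fun he ↦ by
        have h₃ := hwb z hz
        rw [← sub_eq_zero.1 he, norm_one] at h₃
        exact lt_irrefl _ h₃
      simp only [gExpr, phi, Complex.ofReal_zero, sub_zero, one_mul, zero_mul, add_zero] at h₁
      rw [h₁, div_mul_cancel₀ _ h₂])
  obtain ⟨e₀, e₁, e₂, e₃⟩ := jl.unique jr
  refine ⟨?_, ?_, ?_, norm_coeff_le_of_norm_le_one hhd hhb⟩ <;> grind

/-- The coefficients of the inverse function. -/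
theorem coeff_inverse {f g : ℂ → ℂ} (hf : AnalyticAt ℂ f 0) (hg : AnalyticAt ℂ g 0)
    (hf0 : f 0 = 0) (hf1 : deriv f 0 = 1) (hfg : ∀ᶠ z in 𝓝 (0 : ℂ), g (f z) = z) :
    coeff g 2 = - coeff f 2 ∧ coeff g 3 = 2 * coeff f 2 ^ 2 - coeff f 3 ∧
      coeff g 4 = -(5 * coeff f 2 ^ 3 - 5 * coeff f 2 * coeff f 3 + coeff f 4) := by
  have jf := Jet.of_analyticAt hf
  rw [show coeff f 0 = 0 by simp [coeff, hf0], show coeff f 1 = 1 by simp [coeff, hf1]] at jf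
  have jc := (jet_deriv hg).comp jf hf0 hf.continuousAt
  -- Differentiating g(f(z)) = z keeps the comparison at order three.
  have hev : ∀ᶠ z in 𝓝 (0 : ℂ), 1 = deriv g (f z) * deriv f z := by
    have hga : ∀ᶠ z in 𝓝 (0 : ℂ), AnalyticAt ℂ g (f z) :=
      (by simpa [ContinuousAt, hf0] using hf.continuousAt : Tendsto f (𝓝 0) (𝓝 0)).eventually
        hg.eventually_analyticAt
    filter_upwards [hfg.eventually_nhds, hf.eventually_analyticAt, hga] with z h₁ h₂ h₃
    have hd := (h₃.differentiableAt.hasDerivAt.comp z h₂.differentiableAt.hasDerivAt)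
    have hid : HasDerivAt (g ∘ f) 1 z := (hasDerivAt_id z).congr_of_eventuallyEq h₁
    exact hid.unique hd
  obtain ⟨e₀, e₁, e₂, e₃⟩ := (Jet.const 1).unique ((jc.mul (jet_deriv hf)).congr hev)
  rw [hf1] at e₀ e₁ e₂ e₃
  have e₀' : deriv g 0 = 1 := by simpa using e₀.symm
  rw [e₀'] at e₁ e₂ e₃
  have k₁ : coeff g 2 = - coeff f 2 := by linear_combination -e₁ / 2
  rw [k₁] at e₂ e₃
  have k₂ : coeff g 3 = 2 * coeff f 2 ^ 2 - coeff f 3 := by linear_combination -e₂ / 3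
  rw [k₂] at e₃
  exact ⟨k₁, k₂, by linear_combination -e₃ / 4⟩

/-! ### Reduction to a quadratic in r². -/

/-- The bound obtained from the triangle inequality is a quadratic polynomial in `r²`. -/
theorem triangle_bound_le {t r l m : ℝ} (ht : 0 ≤ t) (hr0 : 0 ≤ r) (hr1 : r ≤ 1)
    (hl0 : 0 ≤ l) (hl1 : l ≤ 1) (hm0 : 0 ≤ m) (hm1 : m ≤ 1) :
    r ^ 4 * (1 / 2 + t ^ 2) + (1 - r ^ 2) * ((r ^ 2 / 2 + t * r ^ 2 / 6) * (l + m) +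
      r / 4 * (((1 - l ^ 2) + r * l ^ 2) + ((1 - m ^ 2) + r * m ^ 2))) +
      (1 - r ^ 2) ^ 2 * (l + m) ^ 2 / 9 ≤
    r ^ 4 * (9 * t ^ 2 - 3 * t - 5) / 9 + r ^ 2 * (11 + 6 * t) / 18 + 4 / 9 := by
  have hd : 0 ≤ 1 - r ^ 2 := by nlinarith
  have mono : ∀ x n : ℝ, 0 ≤ x → x ≤ 1 → 0 ≤ n →
      (r ^ 2 / 2 + t * r ^ 2 / 6) * x - r / 4 * (1 - r) * x ^ 2 +
        (1 - r ^ 2) * (x + n) ^ 2 / 9 ≤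
      (r ^ 2 / 2 + t * r ^ 2 / 6) - r / 4 * (1 - r) + (1 - r ^ 2) * (1 + n) ^ 2 / 9 := by
    intro x n hx0 hx1 hn
    have h₁ : 0 ≤ t * r ^ 2 / 6 := by positivity
    -- This is the increment from x to 1 divided by 1 - x.
    have key : 0 ≤ (r ^ 2 / 2 + t * r ^ 2 / 6) - r / 4 * (1 - r) * (1 + x) +
        (1 - r ^ 2) * (1 + x + 2 * n) / 9 := by
      have h₂ : 0 ≤ (1 - r ^ 2) * n := mul_nonneg hd hn
      have h₃ : 0 ≤ r ^ 2 / 2 - r / 4 * (1 - r) * (1 + x) + (1 - r ^ 2) * (1 + x) / 9 := by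
        nlinarith [mul_nonneg (sq_nonneg r) (sub_nonneg.2 hx1), mul_nonneg hx0 (sq_nonneg (r - 1/2)),
          sq_nonneg (r - 1/2), mul_nonneg hx0 (sq_nonneg (14 * r - 9)), sq_nonneg (14 * r - 9)]
      linarith
    nlinarith [mul_nonneg (sub_nonneg.2 hx1) key]
  -- Raise l to 1 first, then m.
  have h₁ := mono l m hl0 hl1 hm0
  have h₂ := mono m 1 hm0 hm1 zero_le_one
  have h₃ := mul_le_mul_of_nonneg_left (add_le_add h₁ h₂) hd
  nlinarith [h₃]

/-- The Hankel determinant in terms of Schwarz coefficients. -/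
theorem norm_hankel_le {t : ℝ} (ht : 0 ≤ t) {a b c b' c' : ℂ} {l m : ℝ} (ha : ‖a‖ ≤ 1)
    (hl0 : 0 ≤ l) (hl1 : l ≤ 1) (hb : ‖b‖ = (1 - ‖a‖ ^ 2) * l)
    (hc : ‖c‖ ≤ (1 - ‖a‖ ^ 2) * ((1 - l ^ 2) + ‖a‖ * l ^ 2))
    (hm0 : 0 ≤ m) (hm1 : m ≤ 1) (hb' : ‖b'‖ = (1 - ‖a‖ ^ 2) * m)
    (hc' : ‖c'‖ ≤ (1 - ‖a‖ ^ 2) * ((1 - m ^ 2) + ‖a‖ * m ^ 2)) :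
    ‖a ^ 4 / 2 + a ^ 2 * (b + b') / 2 + a * (c - c') / 4 + t * a ^ 2 * (b - b') / 6 -
      t ^ 2 * a ^ 4 - (b - b') ^ 2 / 9‖ ≤
    ‖a‖ ^ 4 * (9 * t ^ 2 - 3 * t - 5) / 9 + ‖a‖ ^ 2 * (11 + 6 * t) / 18 + 4 / 9 := by
  refine le_trans ?_ (triangle_bound_le ht (norm_nonneg a) ha hl0 hl1 hm0 hm1)
  have hsub : ‖b - b'‖ ≤ (1 - ‖a‖ ^ 2) * (l + m) := by
    refine (norm_sub_le _ _).trans_eq ?_; rw [hb, hb']; ring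
  have hadd : ‖b + b'‖ ≤ (1 - ‖a‖ ^ 2) * (l + m) := by
    refine (norm_add_le _ _).trans_eq ?_; rw [hb, hb']; ring
  have hcc : ‖c - c'‖ ≤ (1 - ‖a‖ ^ 2) * (((1 - l ^ 2) + ‖a‖ * l ^ 2) +
      ((1 - m ^ 2) + ‖a‖ * m ^ 2)) := by
    refine (norm_sub_le _ _).trans ?_; linarith
  have htn : ‖(t : ℂ)‖ = t := by rw [Complex.norm_real, Real.norm_of_nonneg ht]
  calc _ ≤ ‖a ^ 4 / 2‖ + ‖a ^ 2 * (b + b') / 2‖ + ‖a * (c - c') / 4‖ +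
        ‖(t : ℂ) * a ^ 2 * (b - b') / 6‖ + ‖(t : ℂ) ^ 2 * a ^ 4‖ + ‖(b - b') ^ 2 / 9‖ := by
        refine (norm_sub_le _ _).trans (add_le_add_left ?_ _)
        refine (norm_sub_le _ _).trans (add_le_add_left ?_ _)
        exact norm_add₄_le
    _ = ‖a‖ ^ 4 / 2 + ‖a‖ ^ 2 * ‖b + b'‖ / 2 + ‖a‖ * ‖c - c'‖ / 4 +
        t * ‖a‖ ^ 2 * ‖b - b'‖ / 6 + t ^ 2 * ‖a‖ ^ 4 + ‖b - b'‖ ^ 2 / 9 := by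
        simp only [norm_mul, norm_div, norm_pow, htn, Complex.norm_ofNat]
    _ ≤ ‖a‖ ^ 4 / 2 + ‖a‖ ^ 2 * ((1 - ‖a‖ ^ 2) * (l + m)) / 2 + ‖a‖ * ((1 - ‖a‖ ^ 2) *
        (((1 - l ^ 2) + ‖a‖ * l ^ 2) + ((1 - m ^ 2) + ‖a‖ * m ^ 2))) / 4 +
        t * ‖a‖ ^ 2 * ((1 - ‖a‖ ^ 2) * (l + m)) / 6 + t ^ 2 * ‖a‖ ^ 4 +
        ((1 - ‖a‖ ^ 2) * (l + m)) ^ 2 / 9 := by gcongr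
    _ = _ := by ring

/-- The Hankel determinant bound before maximizing over `r = |a₂| / (1 - β)`. -/
theorem ClassH.exists_norm_hankel_le {β : ℝ} (hβ : β < 1) {f : ℂ → ℂ} (hf : ClassH β f) :
    ∃ r : ℝ, 0 ≤ r ∧ r ≤ 1 ∧ ‖coeff f 2 * coeff f 4 - coeff f 3 ^ 2‖ ≤ (1 - β) ^ 2 *
      (r ^ 4 * (9 * (1 - β) ^ 2 - 3 * (1 - β) - 5) / 9 + r ^ 2 * (11 + 6 * (1 - β)) / 18 +
        4 / 9) := by
  obtain ⟨⟨⟨⟨hfd, hf0, hf1⟩, -⟩, -⟩, hsf, g, ⟨hgd, -, hgf⟩, hsg⟩ := hf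
  have hfa := analyticAt_zero hfd
  have hga := analyticAt_zero hgd
  obtain ⟨a, b, c, f₂, f₃, f₄, ha, l, hl0, hl1, hb, hc⟩ := coeff_of_deriv_subordinate hfa hsf
  obtain ⟨a', b', c', g₂, g₃, g₄, -, m, hm0, hm1, hb', hc'⟩ := coeff_of_deriv_subordinate hga hsg
  obtain ⟨i₂, i₃, i₄⟩ := coeff_inverse hfa hga hf0 hf1 hgf
  have ht : 0 < 1 - β := by linarith
  have htc : (1 - (β : ℂ)) ≠ 0 := by exact_mod_cast ht.ne'
  have haa : a' = -a := by
    apply mul_left_cancel₀ htc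
    rw [← g₂, i₂, f₂]; ring
  subst haa
  rw [norm_neg] at hb' hc'
  refine ⟨‖a‖, norm_nonneg a, ha, ?_⟩
  have key := norm_hankel_le ht.le ha hl0 hl1 hb hc hm0 hm1 hb' hc'
  refine le_trans (le_of_eq ?_) (mul_le_mul_of_nonneg_left key (sq_nonneg (1 - β)))
  have hn : (1 - β) ^ 2 = ‖(1 - (β : ℂ)) ^ 2‖ := by
    rw [norm_pow, ← Complex.ofReal_one, ← Complex.ofReal_sub, Complex.norm_real,
      Real.norm_of_nonneg ht.le]
  rw [hn, ← norm_mul]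
  congr 1
  push_cast
  -- Subtracting the relations for f and g cancels a², as a' = -a.
  have A₃ : coeff f 3 = coeff f 2 ^ 2 + (1 - β) * (b - b') / 3 := by
    rw [i₃] at g₃
    linear_combination f₃ / 6 - g₃ / 6
  have A₄ : coeff f 4 = (1 - β) * (c - c' + 2 * a * (b + b') + 2 * a ^ 3) / 4 +
      5 / 6 * coeff f 2 * (1 - β) * (b - b') := by
    rw [i₄] at g₄
    linear_combination f₄ / 4 - g₄ / 4 + 5 / 2 * coeff f 2 * A₃
  rw [A₄, A₃, f₂]
  ring

end BiUnivalent

/-! ### Maximizing the quadratic. -/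

theorem mainTheorem4 (β : ℝ) (hβ0 : 0 ≤ β) (hβ1 : β < 1) (f : ℂ → ℂ)
    (hf : BiUnivalent.ClassH β f) :
    (β ≤ (11 - Real.sqrt 37) / 12 →
      ‖BiUnivalent.coeff f 2 * BiUnivalent.coeff f 4 - BiUnivalent.coeff f 3 ^ 2‖ ≤
        (1 - β) ^ 2 * (1 + 2 * (1 - β) ^ 2) / 2) ∧
    ((11 - Real.sqrt 37) / 12 < β →
      ‖BiUnivalent.coeff f 2 * BiUnivalent.coeff f 4 - BiUnivalent.coeff f 3 ^ 2‖ ≤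
        (1 - β) ^ 2 * (60 * β ^ 2 - 84 * β - 25) / (16 * (9 * β ^ 2 - 15 * β + 1))) := by
  obtain ⟨r, hr0, hr1, hr⟩ := hf.exists_norm_hankel_le hβ1
  obtain ⟨t, rfl⟩ : ∃ t, β = 1 - t := ⟨1 - β, by ring⟩
  rw [sub_sub_cancel] at hr ⊢
  have ht : 0 < t := by linarith
  have hs : Real.sqrt 37 ^ 2 = 37 := Real.sq_sqrt (by norm_num)
  have hs0 : 0 ≤ Real.sqrt 37 := Real.sqrt_nonneg _
  have hs6 : 6 < Real.sqrt 37 := Real.lt_sqrt_of_sq_lt (by norm_num)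
  have hx1 : r ^ 2 ≤ 1 := by nlinarith
  have hx0 : 0 ≤ r ^ 2 := sq_nonneg r
  refine ⟨fun h ↦ hr.trans ?_, fun h ↦ hr.trans ?_⟩
  · have hq : 0 ≤ 12 * t ^ 2 - 2 * t - 3 := by
      have : 0 ≤ (12 * t - 1 - √37) * (12 * t - 1 + √37) :=
        mul_nonneg (by linarith) (by linarith)
      nlinarith
    rw [mul_div_assoc (t ^ 2)]
    refine mul_le_mul_of_nonneg_left ?_ (sq_nonneg t)
    -- Times (1 - x)/18, this is the value at 1 minus the value at x. It is affine in x, equal to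
    -- 18t² + 1 at 0 and 3(12t² - 2t - 3) at 1.
    have hlin : 0 ≤ 2 * (9 * t ^ 2 - 3 * t - 5) * (1 + r ^ 2) + (11 + 6 * t) := by
      nlinarith [mul_nonneg hx0 hq, mul_nonneg (sub_nonneg.2 hx1) (sq_nonneg t)]
    nlinarith [mul_nonneg (sub_nonneg.2 hx1) hlin]
  · have hq : 12 * t ^ 2 - 2 * t - 3 < 0 := by
      have : (12 * t - 1 - √37) * (12 * t - 1 + √37) < 0 :=
        mul_neg_of_neg_of_pos (by linarith) (by linarith)
      nlinarith
    have hA : 9 * t ^ 2 - 3 * t - 5 < 0 := by nlinarith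
    have hden : 9 * (1 - t) ^ 2 - 15 * (1 - t) + 1 = 9 * t ^ 2 - 3 * t - 5 := by ring
    have hnum : 60 * (1 - t) ^ 2 - 84 * (1 - t) - 25 = 60 * t ^ 2 - 36 * t - 49 := by ring
    rw [hden, hnum, mul_div_assoc (t ^ 2)]
    refine mul_le_mul_of_nonneg_left ?_ (sq_nonneg t)
    rw [le_div_iff_of_neg (by linarith)]
    -- Completing the square: this square vanishes at the vertex.
    nlinarith [sq_nonneg (4 * (9 * t ^ 2 - 3 * t - 5) * r ^ 2 + (11 + 6 * t))]
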